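/- Let $G=\mathbb{Z}/3\mathbb{Z}\star\mathbb{Z}/3\mathbb{Z}$ be the free product, let $a$ and $b$ be generators of the two factors, and let $|g|$ denote the word length of $g\in G$ with respect to $\Sigma=\{a,a^2,b,b^2\}$. Let $\mu$ be a probability measure on $G$, let $x_0,x_1,\dots$ be independent $G$-valued random variables with law $\mu$, and let $X_n=x_0x_1\cdots x_{n-1}$ be the associated right random walk, $X_0=1$. We say that the walk has drift $\gamma$ if $|X_n|/n\to\gamma$ almost surely and in $L^r$ for every $1\le r<\infty$. Then the following hold. (i) If $0\le p\le \frac12$, $\mu(a)=\mu(b)=p$ and $\mu(a^2)=\mu(b^2)=\frac12-p$, the walk has drift $$\gamma=-\frac14+\frac14\sqrt{16p^2-8p+5}.$$ (ii) If $0\le p\le \frac12$, $\mu(a)=\mu(a^2)=p$ and $\mu(b)=\mu(b^2)=\frac12-p$, the walk has drift $$\gamma=2p(1-2p).$$ (iii) If $p,q\ge 0$, $p+q\le 1$, $\mu(a)=p$, $\mu(a^2)=q$ and $\mu(b)=\mu(b^2)=\frac{1-p-q}{2}$, the walk has drift $$\gamma=2(1-p-q)\sqrt{\frac{p^2+q^2+pq}{p^2+q^2-2pq+3}}.$$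 -/

import Mathlib

open MeasureTheory ProbabilityTheory Filter Topology

/-- The word length of `g` with respect to `S`: the least `n` such that `g` is a product of `n`
elements of `S` (with value `0` if there is none, which cannot happen when `S` generates `G` as a
monoid). -/
noncomputable def wordLength {G : Type*} [Monoid G] (S : Set G) (g : G) : ℕ :=
  sInf {n | ∃ l : List G, (∀ x ∈ l, x ∈ S) ∧ l.prod = g ∧ l.length = n}

/-- The natural generators of a free product: the nontrivial elements of the two factors. -/
def freeProductGenerators (H K : Type*) [Group H] [Group K] : Set (Monoid.Coprod H K) :=
  (Set.range Monoid.Coprod.inl ∪ Set.range Monoid.Coprod.inr) \ {1}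

/-- The positions of the right random walk started at the identity with successive increments
`ξ 0, ξ 1, …`: the position at time `n` is `ξ 0 * ξ 1 * ⋯ * ξ (n - 1)`. -/
def walkPosition {G Ω : Type*} [Monoid G] (ξ : ℕ → Ω → G) : ℕ → Ω → G
  | 0, _ => 1
  | n + 1, ω => walkPosition ξ n ω * ξ n ω

/-- The random process `X` in `G` has drift `γ` with respect to the generating set `S`: the word
length of `X n`, divided by `n`, converges to `γ` almost surely and in `L^r` for every
`1 ≤ r < ∞`. -/
structure HasDrift {G Ω : Type*} [Monoid G] [MeasurableSpace Ω] (P : Measure Ω)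
    (S : Set G) (X : ℕ → Ω → G) (γ : ℝ) : Prop where
  ae_tendsto : ∀ᵐ ω ∂P, Tendsto (fun n : ℕ => (wordLength S (X n ω) : ℝ) / n) atTop (𝓝 γ)
  tendsto_eLpNorm : ∀ r : ENNReal, 1 ≤ r → r ≠ ⊤ →
    Tendsto (fun n : ℕ => eLpNorm (fun ω => (wordLength S (X n ω) : ℝ) / n - γ) r P) atTop (𝓝 0)

/-- The cyclic group of order three, written multiplicatively. -/
abbrev C3 : Type := Multiplicative (ZMod 3)

/-- The free product of two cyclic groups of order three. -/
abbrev C3FreeC3 : Type := Monoid.Coprod C3 C3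

instance : MeasurableSpace C3FreeC3 := ⊤

namespace C3FreeC3

/-- The generator of the first factor. -/
def a : C3FreeC3 := Monoid.Coprod.inl (Multiplicative.ofAdd (1 : ZMod 3))

/-- The generator of the second factor. -/
def b : C3FreeC3 := Monoid.Coprod.inr (Multiplicative.ofAdd (1 : ZMod 3))

end C3FreeC3

/-! The walk grows like its length corrected by a bounded function, and the corrected length minus a
linear term is a martingale. Let W be a random infinite reduced word whose first letter has law ν
and whose later letters are drawn independently from ν conditioned on the alternating factor. For a
step x, the first letter of xW is a given letter in three ways: x is that letter and W starts in the
other factor; x and the first letter of W merge into it; or x cancels the first letter of W and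
exposes it. Equating its law with ν gives the equations in `IsStationary`.

Given such ν, subtract from |g| the expected length lost when g is multiplied by W. The loss is 1 at
a merge and 2 at a cancellation, after which it continues with W conditioned to start in the other
factor; this is the recursion `loss`. By `sum_height_act` one step changes the resulting `height` by
the constant `escapeRate` on average, whatever the current word. Since the loss is bounded
(`loss_bounds`), `height` of the position minus n times the rate is a martingale with bounded
increments. A fourth moment estimate gives its strong law (`ae_tendsto_div_of_orthogonal`), hence
almost sure convergence of |X_n|/n. Convergence in L^r follows by domination, as |X_n| ≤ n almost
surely.

It remains to solve the stationarity equations explicitly for (i) and (iii), where symmetry makes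
them quadratic; (ii) is the case q = p of (iii). Lengths are computed by letting the group act on
reduced words, which yields normal forms. -/

/-! ### Reduced words and the right action of the group on them -/

/-- The reduced words of the free product of two cyclic groups of order three, last letter first.
The word `cons t σ l` has its last letter in the factor `t`, with exponent sign `σ`, and the signs
of the remaining letters, which alternate between the two factors, are listed in `l`. -/
inductive AltWord : Type
  | one : AltWord
  | cons (t σ : Bool) (l : List Bool) : AltWord

namespace AltWord

/-- The reduced word with signs `l` whose last letter, if any, is in the factor `t`. -/
def ofList (t : Bool) : List Bool → AltWord
  | [] => one
  | σ :: l => cons t σ l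

/-- The number of letters. -/
def len : AltWord → ℕ
  | one => 0
  | cons _ _ l => l.length + 1

lemma len_cons (t σ : Bool) (l : List Bool) : (cons t σ l).len = l.length + 1 := rfl

/-- Right multiplication by the generator of the factor `t`. -/
def rot (t : Bool) : AltWord → AltWord
  | one => cons t true []
  | cons t' σ l =>
    if t' = t then (if σ then cons t false l else ofList (!t) l) else cons t true (σ :: l)

/-- Right multiplication by the letter of the factor `t` with sign `σ`. -/
def act (t σ : Bool) (v : AltWord) : AltWord :=
  if σ then rot t v else rot t (rot t v)

@[simp] lemma len_ofList (t : Bool) (l : List Bool) : (ofList t l).len = l.length := by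
  cases l <;> rfl

lemma rot_ofList_not (t : Bool) (l : List Bool) : rot t (ofList (!t) l) = cons t true l := by
  cases t <;> cases l <;> rfl

lemma rot_cons_true (t : Bool) (l : List Bool) : rot t (cons t true l) = cons t false l := by
  simp [rot]

lemma rot_cons_false (t : Bool) (l : List Bool) : rot t (cons t false l) = ofList (!t) l := by
  simp [rot]

/-- Every word is, for each factor `t`, a word not ending in `t` followed by at most one letter
of `t`. -/
lemma exists_ofList_or_cons (t : Bool) (v : AltWord) :
    ∃ l, v = ofList (!t) l ∨ ∃ σ, v = cons t σ l := by
  cases v with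
  | one => exact ⟨[], Or.inl rfl⟩
  | cons t' σ l =>
    by_cases h : t' = t
    · exact ⟨l, Or.inr ⟨σ, by rw [h]⟩⟩
    · refine ⟨σ :: l, Or.inl ?_⟩
      cases t <;> cases t' <;> simp_all [ofList]

lemma rot_rot_rot (t : Bool) (v : AltWord) : rot t (rot t (rot t v)) = v := by
  obtain ⟨l, rfl | ⟨σ, rfl⟩⟩ := exists_ofList_or_cons t v
  · simp only [rot_ofList_not, rot_cons_true, rot_cons_false]
  · cases σ <;> simp only [rot_ofList_not, rot_cons_true, rot_cons_false]

lemma act_ofList_not (t σ : Bool) (l : List Bool) : act t σ (ofList (!t) l) = cons t σ l := by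
  cases σ <;> simp [act, rot_ofList_not, rot_cons_true]

lemma act_cons_self (t σ : Bool) (l : List Bool) : act t σ (cons t σ l) = cons t (!σ) l := by
  cases σ <;> simp [act, rot_ofList_not, rot_cons_true, rot_cons_false]

lemma act_cons_not (t σ : Bool) (l : List Bool) : act t (!σ) (cons t σ l) = ofList (!t) l := by
  cases σ <;> simp [act, rot_cons_true, rot_cons_false]

lemma len_act_le (t σ : Bool) (v : AltWord) : (act t σ v).len ≤ v.len + 1 := by
  obtain ⟨l, rfl | ⟨τ, rfl⟩⟩ := exists_ofList_or_cons t v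
  · simp [act_ofList_not, len_cons]
  · by_cases h : τ = σ
    · subst h; simp [act_cons_self, len_cons]
    · obtain rfl : σ = !τ := by cases σ <;> cases τ <;> simp_all
      simp only [act_cons_not, len_ofList, len_cons]; omega

/-- `AltWord.rot` as an element of the monoid of self-maps. -/
def rotEnd (t : Bool) : Function.End AltWord := rot t

lemma rotEnd_pow_three (t : Bool) : rotEnd t ^ 3 = 1 := funext (rot_rot_rot t)

/-- The right action of a cyclic factor on reduced words. -/
def factorHom (t : Bool) : C3 →* (Function.End AltWord)ᵐᵒᵖ where
  toFun x := MulOpposite.op (rotEnd t ^ (x.toAdd.val))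
  map_one' := by
    rw [toAdd_one, ZMod.val_zero, pow_zero, MulOpposite.op_one]
  map_mul' x y := by
    -- Addition in `ZMod 3` reduces exponents mod 3, which is harmless because `rotEnd t` has order
    -- dividing 3.
    rw [← MulOpposite.op_mul, ← pow_add, toAdd_mul, ZMod.val_add, ← pow_mod_orderOf,
      Nat.mod_mod_of_dvd _ (orderOf_dvd_of_pow_eq_one (rotEnd_pow_three t)), pow_mod_orderOf,
      add_comm]

lemma factorHom_apply (t : Bool) (x : C3) (v : AltWord) :
    (factorHom t x).unop v = (rotEnd t ^ (x.toAdd.val)) v := rfl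

/-- The right action of the free product on reduced words. -/
def actionHom : C3FreeC3 →* (Function.End AltWord)ᵐᵒᵖ :=
  Monoid.Coprod.lift (factorHom false) (factorHom true)

end AltWord

/-! ### Normal forms and word length -/

namespace C3FreeC3

open AltWord

/-- The letter of the factor `t` with sign `σ`. -/
noncomputable def letter (t σ : Bool) : C3FreeC3 :=
  (if t then b else a) ^ (if σ then 1 else 2)

/-- The reduced word of an element of the free product. -/
def word (g : C3FreeC3) : AltWord := (actionHom g).unop AltWord.one

@[simp] lemma word_one : word 1 = AltWord.one := by
  rw [word, map_one]; rfl

lemma actionHom_letter (t σ : Bool) (v : AltWord) :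
    (actionHom (letter t σ)).unop v = act t σ v := by
  have h : (1 : ZMod 3).val = 1 := rfl
  have h (t : Bool) (v : AltWord) :
      (factorHom t (Multiplicative.ofAdd 1)).unop v = rot t v := by
    rw [factorHom_apply, toAdd_ofAdd, h, pow_one]; rfl
  cases t <;> cases σ <;>
    simp [letter, actionHom, a, b, act, h, pow_two, Function.End.mul_def] <;>
    exact (h _ _).trans (congrArg _ (h _ _))

lemma word_mul_letter (g : C3FreeC3) (t σ : Bool) : word (g * letter t σ) = act t σ (word g) := by
  rw [word, map_mul, MulOpposite.unop_mul, ← actionHom_letter]; rfl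

lemma letter_pow_three (t : Bool) : letter t true ^ 3 = 1 := by
  have h : (Multiplicative.ofAdd (1 : ZMod 3)) ^ 3 = 1 := rfl
  cases t <;> simp [letter, a, b, ← map_pow, h]

lemma letter_false (t : Bool) : letter t false = letter t true ^ 2 := by simp [letter]

/-- The product of the alternating word with signs `l` whose last letter is in the factor `t`. -/
noncomputable def ofSigns : Bool → List Bool → C3FreeC3
  | _, [] => 1
  | t, σ :: l => ofSigns (!t) l * letter t σ

/-- The element of the free product represented by a reduced word. -/
noncomputable def ofWord : AltWord → C3FreeC3
  | AltWord.one => 1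
  | AltWord.cons t σ l => ofSigns t (σ :: l)

lemma ofWord_cons (t σ : Bool) (l : List Bool) :
    ofWord (AltWord.cons t σ l) = ofSigns (!t) l * letter t σ := rfl

lemma ofWord_ofList (t : Bool) (l : List Bool) : ofWord (ofList t l) = ofSigns t l := by
  cases l <;> rfl

lemma ofWord_rot (t : Bool) (v : AltWord) : ofWord (rot t v) = ofWord v * letter t true := by
  obtain ⟨l, rfl | ⟨σ, rfl⟩⟩ := exists_ofList_or_cons t v
  · simp [rot_ofList_not, ofWord_ofList, ofWord_cons]
  · cases σ
    · simp only [rot_cons_false, ofWord_ofList, ofWord_cons, letter_false]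
      rw [mul_assoc, ← pow_succ, letter_pow_three, mul_one]
    · simp only [rot_cons_true, ofWord_cons, letter_false]
      rw [mul_assoc, pow_two]

lemma ofWord_pow_rot (t : Bool) (n : ℕ) (v : AltWord) :
    ofWord ((rotEnd t ^ n) v) = ofWord v * letter t true ^ n := by
  induction n generalizing v with
  | zero => rw [pow_zero, pow_zero, mul_one]; rfl
  | succ n ih =>
    rw [pow_succ, pow_succ', ← mul_assoc, ← ofWord_rot, ← ih]; rfl

lemma inl_eq_letter_pow (x : C3) :
    (Monoid.Coprod.inl x : C3FreeC3) = letter false true ^ (x.toAdd.val) := by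
  have h : x = Multiplicative.ofAdd (1 : ZMod 3) ^ (x.toAdd.val) := by
    rw [← ofAdd_nsmul]; simp
  conv_lhs => rw [h]
  simp [letter, a]

lemma inr_eq_letter_pow (x : C3) :
    (Monoid.Coprod.inr x : C3FreeC3) = letter true true ^ (x.toAdd.val) := by
  have h : x = Multiplicative.ofAdd (1 : ZMod 3) ^ (x.toAdd.val) := by
    rw [← ofAdd_nsmul]; simp
  conv_lhs => rw [h]
  simp [letter, b]

/-- The two operations agree on each factor, hence on products. At the empty word this makes
`ofWord` a left inverse of `word`, so normal forms determine elements. -/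
lemma ofWord_actionHom (g : C3FreeC3) (v : AltWord) :
    ofWord ((actionHom g).unop v) = ofWord v * g := by
  induction g using Monoid.Coprod.induction_on generalizing v with
  | inl x =>
    rw [inl_eq_letter_pow, ← ofWord_pow_rot, ← inl_eq_letter_pow]
    rfl
  | inr x =>
    rw [inr_eq_letter_pow, ← ofWord_pow_rot, ← inr_eq_letter_pow]
    rfl
  | mul x y hx hy =>
    rw [map_mul, MulOpposite.unop_mul, ← mul_assoc, ← hx, ← hy]; rfl

lemma ofWord_word (g : C3FreeC3) : ofWord (word g) = g := by
  rw [word, ofWord_actionHom]; exact one_mul g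

lemma word_letter (t σ : Bool) : word (letter t σ) = AltWord.cons t σ [] := by
  rw [← one_mul (letter t σ), word_mul_letter, word_one]
  exact act_ofList_not t σ []

lemma letter_injective {t σ t' σ' : Bool} (h : letter t σ = letter t' σ') : t = t' ∧ σ = σ' := by
  have := congrArg word h
  simpa [word_letter] using this

lemma letter_mem (t σ : Bool) : letter t σ ∈ freeProductGenerators C3 C3 := by
  refine ⟨?_, fun h => ?_⟩
  · cases t
    · exact Or.inl ⟨Multiplicative.ofAdd 1 ^ (if σ then 1 else 2), by cases σ <;> simp [letter, a]⟩
    · exact Or.inr ⟨Multiplicative.ofAdd 1 ^ (if σ then 1 else 2), by cases σ <;> simp [letter, b]⟩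
  · have := congrArg word (Set.mem_singleton_iff.1 h)
    simp [word_letter] at this

lemma exists_letter_of_mem {x : C3FreeC3} (hx : x ∈ freeProductGenerators C3 C3) :
    ∃ t σ, x = letter t σ := by
  have key : ∀ (t : Bool) (i : ZMod 3), letter t true ^ i.val ≠ 1 →
      ∃ σ, letter t true ^ i.val = letter t σ := by
    intro t i hi
    have h3 : i.val < 3 := ZMod.val_lt i
    interval_cases i.val
    · simp at hi
    · exact ⟨true, pow_one _⟩
    · exact ⟨false, (letter_false t).symm⟩
  obtain ⟨⟨y, rfl⟩ | ⟨y, rfl⟩, h1⟩ := hx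
  · rw [Set.mem_singleton_iff, inl_eq_letter_pow] at h1
    rw [inl_eq_letter_pow]
    exact ⟨false, key _ _ h1⟩
  · rw [Set.mem_singleton_iff, inr_eq_letter_pow] at h1
    rw [inr_eq_letter_pow]
    exact ⟨true, key _ _ h1⟩

lemma len_word_prod_le (l : List C3FreeC3) (hl : ∀ x ∈ l, x ∈ freeProductGenerators C3 C3) :
    (word l.prod).len ≤ l.length := by
  induction l using List.reverseRecOn with
  | nil => simp [AltWord.len]
  | append_singleton l x ih =>
    obtain ⟨t, σ, rfl⟩ := exists_letter_of_mem (hl x (by simp))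
    have := ih fun y hy => hl y (by simp [hy])
    rw [List.prod_append, List.prod_singleton, word_mul_letter, List.length_append,
      List.length_singleton]
    exact (len_act_le _ _ _).trans (by omega)

lemma exists_list_ofSigns (t : Bool) (l : List Bool) :
    ∃ L : List C3FreeC3, (∀ x ∈ L, x ∈ freeProductGenerators C3 C3) ∧ L.prod = ofSigns t l ∧
      L.length = l.length := by
  induction l generalizing t with
  | nil => exact ⟨[], by simp, rfl, rfl⟩
  | cons σ l ih =>
    obtain ⟨L, h1, h2, h3⟩ := ih (!t)
    refine ⟨L ++ [letter t σ], ?_, by simp [ofSigns, h2], by simp [h3]⟩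
    intro x hx
    rcases List.mem_append.1 hx with hx | hx
    · exact h1 x hx
    · rw [List.mem_singleton.1 hx]; exact letter_mem t σ

/-- The word length is the length of the reduced word. -/
lemma wordLength_eq (g : C3FreeC3) :
    wordLength (freeProductGenerators C3 C3) g = (word g).len := by
  have hmem : (word g).len ∈ {n | ∃ l : List C3FreeC3,
      (∀ x ∈ l, x ∈ freeProductGenerators C3 C3) ∧ l.prod = g ∧ l.length = n} := by
    obtain ⟨t, l, h⟩ : ∃ t l, word g = ofList t l := by
      cases h : word g with
      | one => exact ⟨true, [], rfl⟩
      | cons t σ l => exact ⟨t, σ :: l, rfl⟩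
    obtain ⟨L, h1, h2, h3⟩ := exists_list_ofSigns t l
    refine ⟨L, h1, ?_, ?_⟩
    · rw [h2, ← ofWord_ofList, ← h, ofWord_word]
    · rw [h3, h, len_ofList]
  refine le_antisymm (Nat.sInf_le hmem) (le_csInf ⟨_, hmem⟩ ?_)
  rintro n ⟨l, hl, rfl, rfl⟩
  exact len_word_prod_le l hl

end C3FreeC3

/-! ### Stationary weights and the corrected length -/

namespace AltWord

/-- Positive weights `ν` on the letters, of total mass one, which are stationary for the step
weights `m`: they define a Markov measure on infinite reduced words whose first letter has law
`ν`, and this measure is the harmonic measure of the random walk with step law `m`. -/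
structure IsStationary (m ν : Bool → Bool → ℝ) : Prop where
  pos : ∀ t σ, 0 < ν t σ
  sum_eq_one : ∀ t, ν t true + ν t false + (ν (!t) true + ν (!t) false) = 1
  stationary : ∀ t σ, ν t σ * (1 - (m (!t) true * ν (!t) false + m (!t) false * ν (!t) true) /
    (ν t true + ν t false)) = m t (!σ) * ν t (!σ) + m t σ * (ν (!t) true + ν (!t) false)

/-- The rate of escape of the walk with step weights `m` and stationary weights `ν`. -/
def escapeRate (m ν : Bool → Bool → ℝ) : ℝ :=
  1 - ∑ t, ∑ σ, m t σ * (ν t σ + 2 * ν t (!σ))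

/-- The expected loss of length when the word with signs `l`, ending in the factor `t`, is
multiplied by an infinite word distributed according to the harmonic measure. -/
noncomputable def loss (ν : Bool → Bool → ℝ) : Bool → List Bool → ℝ
  | _, [] => 0
  | t, σ :: l => ν t σ + ν t (!σ) * (2 + loss ν (!t) l / (ν (!t) true + ν (!t) false))

/-- The length of a word, corrected by its expected loss. -/
noncomputable def height (ν : Bool → Bool → ℝ) : AltWord → ℝ
  | one => 0
  | cons t σ l => (l.length + 1 : ℝ) - loss ν t (σ :: l)

lemma height_ofList (ν : Bool → Bool → ℝ) (t : Bool) (l : List Bool) :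
    height ν (ofList t l) = l.length - loss ν t l := by
  cases l <;> simp [ofList, height, loss]

lemma height_cons (ν : Bool → Bool → ℝ) (t σ : Bool) (l : List Bool) :
    height ν (cons t σ l) = (l.length + 1 : ℝ) - (ν t σ + ν t (!σ) *
      (2 + loss ν (!t) l / (ν (!t) true + ν (!t) false))) := rfl

variable {m ν : Bool → Bool → ℝ}

lemma sum_bool_eq (t : Bool) (f : Bool → ℝ) : ∑ s, f s = f t + f (!t) := by
  cases t <;> simp [add_comm]

/-- The corrected length has constant drift along the walk. -/
lemma sum_height_act (hν : IsStationary m ν)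
    (hm : ∀ t, m t true + m t false + (m (!t) true + m (!t) false) = 1) (v : AltWord) :
    ∑ t, ∑ σ, m t σ * height ν (act t σ v) = height ν v + escapeRate m ν := by
  cases v with
  | one =>
    have h : ∀ t σ, act t σ one = cons t σ [] := fun t σ => act_ofList_not t σ []
    have h1 := hm true
    simp only [h, loss, height, escapeRate, Fintype.sum_bool, List.length_nil,
      Bool.not_true, Bool.not_false] at h1 ⊢
    push_cast
    linear_combination h1
  | cons t σ l =>
    have hother : ∀ τ, act (!t) τ (cons t σ l) = cons (!t) τ (σ :: l) := fun τ => by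
      have := act_ofList_not (!t) τ (σ :: l)
      rwa [Bool.not_not] at this
    have hB : 0 < ν (!t) true + ν (!t) false := add_pos (hν.pos _ _) (hν.pos _ _)
    have h1 := hm t
    have h2 := hν.sum_eq_one t
    have h3 := hν.stationary t σ
    have h4 := hν.stationary t (!σ)
    rw [sum_bool_eq t, sum_bool_eq σ (fun τ => m t τ * _), act_cons_self, act_cons_not]
    simp only [hother, escapeRate]
    rw [sum_bool_eq t (fun s => ∑ τ, m s τ * (ν s τ + 2 * ν s (!τ))),
      sum_bool_eq σ (fun τ => m t τ * (ν t τ + 2 * ν t (!τ)))]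
    simp only [Fintype.sum_bool, height_cons, height_ofList, loss, Bool.not_not, Bool.not_true,
      Bool.not_false, List.length_cons] at h4 ⊢
    push_cast
    set L := loss ν (!t) l
    set B := ν (!t) true + ν (!t) false
    have hm' : m t σ + m t (!σ) = m t true + m t false := by cases σ <;> simp [add_comm]
    have hν' : ν t σ + ν t (!σ) = ν t true + ν t false := by cases σ <;> simp [add_comm]
    rw [← hm'] at h1
    rw [← hν'] at h2 h3 h4 ⊢
    have h5 : L / B * B = L := div_mul_cancel₀ _ hB.ne'
    -- The stationarity equations for the letters σ and `!σ` enter with the coefficients 1 and 2 +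
    -- L/B that ν t σ and ν t (!σ) have in the loss of the current word.
    linear_combination (l.length + 2 : ℝ) * h1 + (m t σ + 2 * m t (!σ)) * h2 + h3 +
      (2 + L / B) * h4 + m t (!σ) * h5

/-- The induction closes because ν t σ + 2 ν t (!σ) ≤ 2 ≤ C ν t σ: the non-cancelling letter pays
for the loss at this level, and C ν t (!σ) is left for the deeper ones. -/
lemma loss_bounds (hν : IsStationary m ν) {C : ℝ} (hC : ∀ t σ, 2 ≤ C * ν t σ) (t : Bool)
    (l : List Bool) : 0 ≤ loss ν t l ∧ loss ν t l ≤ C * (ν t true + ν t false) := by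
  have hp := hν.pos
  induction l generalizing t with
  | nil =>
    refine ⟨le_rfl, ?_⟩
    have := hC t true; have := hC t false
    simp only [loss]; linarith
  | cons σ l ih =>
    obtain ⟨h0, h1⟩ := ih (!t)
    have hB : 0 < ν (!t) true + ν (!t) false := add_pos (hp _ _) (hp _ _)
    have hq0 : 0 ≤ loss ν (!t) l / (ν (!t) true + ν (!t) false) := div_nonneg h0 hB.le
    have hq1 : loss ν (!t) l / (ν (!t) true + ν (!t) false) ≤ C := (div_le_iff₀ hB).2 h1
    have hν' : ν t σ + ν t (!σ) = ν t true + ν t false := by cases σ <;> simp [add_comm]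
    have h2 := hν.sum_eq_one t
    have h5 := hp t σ
    have h6 := hp t (!σ)
    have h7 := hC t σ
    have h8 := mul_le_mul_of_nonneg_left hq1 h6.le
    have h9 := mul_nonneg h6.le hq0
    simp only [loss]
    rw [← hν'] at h2 ⊢
    constructor <;> nlinarith

/-- The corrected length is within bounded distance of the length. -/
lemma exists_abs_len_sub_height_le (hν : IsStationary m ν) :
    ∃ K : ℝ, ∀ v : AltWord, |(v.len : ℝ) - height ν v| ≤ K := by
  have hp := hν.pos
  obtain ⟨C, hC⟩ : ∃ C : ℝ, ∀ t σ, 2 ≤ C * ν t σ := by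
    refine ⟨∑ t, ∑ σ, 2 / ν t σ, fun t σ => ?_⟩
    rw [← div_le_iff₀ (hp t σ)]
    have h : ∀ t, ∀ σ, 0 ≤ 2 / ν t σ := fun t σ => (div_pos two_pos (hp t σ)).le
    exact (Finset.single_le_sum (f := fun σ => 2 / ν t σ) (fun i _ => h t i)
      (Finset.mem_univ σ)).trans (Finset.single_le_sum (f := fun t => ∑ σ, 2 / ν t σ)
      (fun i _ => Finset.sum_nonneg fun j _ => h i j) (Finset.mem_univ t))
  have hC0 : 0 ≤ C := by
    by_contra! h
    have := hC true true
    have := mul_neg_of_neg_of_pos h (hp true true)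
    linarith
  refine ⟨C, fun v => ?_⟩
  obtain ⟨t, l, rfl⟩ : ∃ t l, v = ofList t l := by
    cases v with
    | one => exact ⟨true, [], rfl⟩
    | cons t σ l => exact ⟨t, σ :: l, rfl⟩
  obtain ⟨h0, h1⟩ := loss_bounds hν hC t l
  rw [height_ofList, len_ofList, sub_sub_cancel, abs_of_nonneg h0]
  refine h1.trans (mul_le_of_le_one_right hC0 ?_)
  have := hν.sum_eq_one t
  have := hp (!t) true
  have := hp (!t) false
  linarith

end AltWord

/-! ### Explicit solutions of the stationarity equations -/

namespace AltWord

/-- Stationary weights for the step weights that give `p` to the generators of both factors and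
`1 / 2 - p` to their squares. -/
lemma exists_isStationary_of_factor_symm {p : ℝ} (hp1 : p ≤ 1 / 2) :
    ∃ ν, IsStationary (fun _ σ => if σ then p else 1 / 2 - p) ν ∧
      escapeRate (fun _ σ => if σ then p else 1 / 2 - p) ν =
        -1 / 4 + Real.sqrt (16 * p ^ 2 - 8 * p + 5) / 4 := by
  set s := Real.sqrt (16 * p ^ 2 - 8 * p + 5) with hs
  have hs2 : s ^ 2 = 16 * p ^ 2 - 8 * p + 5 := Real.sq_sqrt (by nlinarith [sq_nonneg (4 * p - 1)])
  have hs0 : 0 ≤ s := Real.sqrt_nonneg _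
  have hs_pos : 2 ≤ s := by nlinarith [sq_nonneg (4 * p - 1)]
  have hd : 0 < 3 - 4 * p + s := by linarith
  -- Root of the quadratic `hquad` in rationalised form, valid also at p = 1/4 where the leading
  -- coefficient vanishes.
  obtain ⟨r, hr⟩ : ∃ r, r * (3 - 4 * p + s) = 1 := ⟨_, inv_mul_cancel₀ hd.ne'⟩
  have hr0 : 0 < r := by
    by_contra! h
    nlinarith
  have hr1 : r < 1 / 2 := by
    by_contra! h
    nlinarith
  have hrs : r * s = 1 - r * (3 - 4 * p) := by linarith
  have hquad : (4 * p - 1) * r ^ 2 + (3 / 2 - 2 * p) * r - 1 / 4 = 0 := by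
    have h : (r * s) ^ 2 = r ^ 2 * (16 * p ^ 2 - 8 * p + 5) := by rw [mul_pow, hs2]
    rw [hrs] at h
    nlinarith
  refine ⟨fun _ σ => if σ then r else 1 / 2 - r, ⟨?_, ?_, ?_⟩, ?_⟩
  · intro t σ
    cases σ <;> simp <;> linarith
  · intro t
    simp; norm_num
  · intro t σ
    have h : r + (1 / 2 - r) = 1 / 2 := by ring
    cases σ <;> simp only [Bool.not_true, Bool.not_false, if_true, if_false, h,
      Bool.false_eq_true] <;> field_simp <;> nlinarith
  · simp only [escapeRate, Fintype.sum_bool, Bool.not_true, Bool.not_false, if_true, if_false,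
      Bool.false_eq_true]
    have hs' : (s - (4 * (4 * p - 1) * r + 3 - 4 * p)) * r = 0 := by
      linear_combination hrs - 4 * hquad
    linear_combination (-1 / 4) * (mul_eq_zero.1 hs').resolve_right hr0.ne'

/-- Stationary weights for the step weights that give `p` and `q` to the nontrivial elements of
the first factor, and equal weights to those of the second factor. -/
lemma exists_isStationary_of_symm_factor {p q : ℝ} (hp : 0 ≤ p) (hq : 0 ≤ q) (h0 : 0 < p + q)
    (h1 : p + q < 1) :
    ∃ ν, IsStationary (fun t σ => if t then (1 - p - q) / 2 else if σ then p else q) ν ∧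
      escapeRate (fun t σ => if t then (1 - p - q) / 2 else if σ then p else q) ν =
        2 * (1 - p - q) *
          Real.sqrt ((p ^ 2 + q ^ 2 + p * q) / (p ^ 2 + q ^ 2 - 2 * p * q + 3)) := by
  set R := Real.sqrt ((p ^ 2 + q ^ 2 + p * q) / (p ^ 2 + q ^ 2 - 2 * p * q + 3)) with hR
  have hF : 0 < p ^ 2 + q ^ 2 - 2 * p * q + 3 := by nlinarith [sq_nonneg (p - q)]
  have hN : 0 < p ^ 2 + q ^ 2 + p * q := by nlinarith [mul_nonneg hp hq]
  have hR0 : 0 < R := Real.sqrt_pos.2 (div_pos hN hF)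
  have hR2 : R ^ 2 * (p ^ 2 + q ^ 2 - 2 * p * q + 3) = p ^ 2 + q ^ 2 + p * q := by
    rw [hR, Real.sq_sqrt (div_pos hN hF).le, div_mul_cancel₀ _ hF.ne']
  have hR1 : R < 1 := by
    by_contra! h
    have h2 : 1 ≤ R ^ 2 := one_le_pow₀ h
    have h3 := mul_le_mul_of_nonneg_right h2 hF.le
    nlinarith [sq_nonneg (p - q)]
  -- d is the difference of the two weights in the first factor. It should be (2R - (p + q)) / (p -
  -- q); multiplying by the conjugate 2R + (p + q) removes the singularity at p = q.
  obtain ⟨d, hd⟩ : ∃ d, d * ((p ^ 2 + q ^ 2 - 2 * p * q + 3) * (2 * R + (p + q))) =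
      (p - q) * (1 - (p + q) ^ 2) := ⟨_, div_mul_cancel₀ _ (by positivity)⟩
  have hdd : (p - q) * d = 2 * R - (p + q) := by
    have : (p ^ 2 + q ^ 2 - 2 * p * q + 3) * (2 * R + (p + q)) ≠ 0 := by positivity
    apply mul_right_cancel₀ this
    linear_combination (p - q) * hd - 4 * hR2
  -- This gives positivity of the weights ((1 + 2R)/3 ± d)/2.
  have hdlt : |d| < 1 / 3 := by
    by_contra! h
    have h2 := congrArg abs hd
    have h3 : |p - q| ≤ p + q := abs_le.2 ⟨by linarith, by linarith⟩
    have h4 : |1 - (p + q) ^ 2| ≤ 1 := abs_le.2 ⟨by nlinarith, by nlinarith⟩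
    have hE0 : 0 < 2 * R + (p + q) := by positivity
    have hE : 3 * (2 * R + (p + q)) ≤ (p ^ 2 + q ^ 2 - 2 * p * q + 3) * (2 * R + (p + q)) :=
      mul_le_mul_of_nonneg_right (by nlinarith [sq_nonneg (p - q)]) (by positivity)
    rw [abs_mul, abs_mul (p - q), abs_of_pos (mul_pos hF hE0)] at h2
    have h5 := mul_le_mul h3 h4 (abs_nonneg _) h0.le
    have h6 := mul_le_mul h hE (by positivity) (abs_nonneg _)
    linarith
  have hkey : d * (2 * R + (p + q)) = (p - q) * (1 - 4 * R ^ 2) / 3 := by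
    apply mul_right_cancel₀ hF.ne'
    linear_combination hd + (4 / 3) * (p - q) * hR2
  obtain ⟨hd1, hd2⟩ := abs_lt.1 hdlt
  refine ⟨fun t σ => if t then (1 - R) / 3 else if σ then ((1 + 2 * R) / 3 + d) / 2 else
    ((1 + 2 * R) / 3 - d) / 2, ⟨?_, ?_, ?_⟩, ?_⟩
  · intro t σ
    cases t <;> cases σ <;> simp <;> linarith
  · intro t
    cases t <;> simp <;> ring
  · have hα : ((1 + 2 * R) / 3 + d) / 2 + ((1 + 2 * R) / 3 - d) / 2 = (1 + 2 * R) / 3 := by ring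
    have hβ : (1 - R) / 3 + (1 - R) / 3 = 2 * (1 - R) / 3 := by ring
    have hα0 : 1 + 2 * R ≠ 0 := by positivity
    have hβ0 : 1 - R ≠ 0 := by linarith
    intro t σ
    cases t <;> cases σ <;> simp only [Bool.not_true, Bool.not_false, if_true, if_false,
      Bool.false_eq_true, hα, hβ] <;> field_simp
    -- In the first factor `hkey` is the part of the equations odd under exchanging the two letters,
    -- `hdd` the even part.
    · linear_combination -9 * hkey - 3 * (1 + 2 * R) * hdd
    · linear_combination 9 * hkey - 3 * (1 + 2 * R) * hdd
    · linear_combination 3 * hdd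
    · linear_combination 3 * hdd
  · simp only [escapeRate, Fintype.sum_bool, Bool.not_true, Bool.not_false, if_true, if_false,
      Bool.false_eq_true]
    linear_combination (1 / 2) * hdd

end AltWord

/-! ### A strong law for bounded orthogonal increments -/

section BoundedIncrements

variable {Ω : Type*} [MeasurableSpace Ω] {P : Measure Ω}
  {M : ℕ → Ω → ℝ} {C : ℝ}

lemma ae_abs_le_of_abs_sub_le (h0 : M 0 = 0) (hC : ∀ n, ∀ᵐ ω ∂P, |M (n + 1) ω - M n ω| ≤ C)
    (n : ℕ) : ∀ᵐ ω ∂P, |M n ω| ≤ C * n := by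
  induction n with
  | zero => simp [h0]
  | succ n ih =>
    filter_upwards [ih, hC n] with ω h1 h2
    have := abs_add_le (M n ω) (M (n + 1) ω - M n ω)
    rw [add_sub_cancel] at this
    push_cast
    linarith

variable [IsProbabilityMeasure P]

/-- The fourth moment of a sum of bounded increments which are orthogonal to the past and to its
cube. -/
lemma integral_pow_four_le (hC0 : 0 ≤ C) (hM : ∀ n, AEStronglyMeasurable (M n) P) (h0 : M 0 = 0)
    (hC : ∀ n, ∀ᵐ ω ∂P, |M (n + 1) ω - M n ω| ≤ C)
    (h1 : ∀ n, ∫ ω, M n ω * (M (n + 1) ω - M n ω) ∂P = 0)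
    (h3 : ∀ n, ∫ ω, M n ω ^ 3 * (M (n + 1) ω - M n ω) ∂P = 0) (n : ℕ) :
    ∫ ω, M n ω ^ 4 ∂P ≤ 4 * C ^ 4 * n ^ 2 := by
  have hb := ae_abs_le_of_abs_sub_le h0 hC
  have hint (n k l : ℕ) : Integrable (fun ω => M n ω ^ k * (M (n + 1) ω - M n ω) ^ l) P := by
    refine Integrable.of_bound
      (((hM n).pow k).mul (((hM (n + 1)).sub (hM n)).pow l)) ((C * n) ^ k * C ^ l) ?_
    filter_upwards [hb n, hC n] with ω h1 h2
    rw [Real.norm_eq_abs, abs_mul, abs_pow, abs_pow]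
    gcongr
  have hint' (n k : ℕ) : Integrable (fun ω => M n ω ^ k) P := by simpa using hint n k 0
  have hsq (n : ℕ) : ∫ ω, M n ω ^ 2 ∂P ≤ C ^ 2 * n := by
    induction n with
    | zero => simp [h0]
    | succ n ih =>
      have hi : Integrable
          (fun ω => M n ω ^ 2 + 2 * (M n ω ^ 1 * (M (n + 1) ω - M n ω) ^ 1)) P :=
        (hint' n 2).add ((hint n 1 1).const_mul 2)
      have hle : ∫ ω, M (n + 1) ω ^ 2 ∂P ≤
          ∫ ω, (M n ω ^ 2 + 2 * (M n ω ^ 1 * (M (n + 1) ω - M n ω) ^ 1) + C ^ 2) ∂P := by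
        refine integral_mono_ae (hint' _ _)
          (hi.add (integrable_const _)) ?_
        filter_upwards [hC n] with ω h
        have := sq_le_sq' (abs_le.1 h).1 (abs_le.1 h).2
        nlinarith
      rw [integral_add hi (integrable_const _),
        integral_add (hint' n 2) ((hint n 1 1).const_mul 2), integral_const_mul] at hle
      simp only [pow_one, h1, integral_const, probReal_univ, smul_eq_mul] at hle
      push_cast
      linarith
  induction n with
  | zero => simp [h0]
  | succ n ih =>
    have hi : Integrable
        (fun ω => M n ω ^ 4 + 4 * (M n ω ^ 3 * (M (n + 1) ω - M n ω) ^ 1)) P :=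
      (hint' n 4).add ((hint n 3 1).const_mul 4)
    have hi' : Integrable (fun ω => M n ω ^ 4 + 4 * (M n ω ^ 3 * (M (n + 1) ω - M n ω) ^ 1) +
        8 * C ^ 2 * M n ω ^ 2) P :=
      hi.add ((hint' n 2).const_mul _)
    have hle : ∫ ω, M (n + 1) ω ^ 4 ∂P ≤
        ∫ ω, (M n ω ^ 4 + 4 * (M n ω ^ 3 * (M (n + 1) ω - M n ω) ^ 1) + 8 * C ^ 2 * M n ω ^ 2 +
          3 * C ^ 4) ∂P := by
      refine integral_mono_ae (hint' _ _) (hi'.add (integrable_const _)) ?_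
      filter_upwards [hC n] with ω h
      obtain ⟨d, hd⟩ : ∃ d, M (n + 1) ω - M n ω = d := ⟨_, rfl⟩
      have hd' : M (n + 1) ω = M n ω + d := by linarith
      rw [hd] at h ⊢
      rw [hd']
      have h2 : d ^ 2 ≤ C ^ 2 := sq_le_sq' (abs_le.1 h).1 (abs_le.1 h).2
      have h4 : d ^ 4 ≤ C ^ 4 := by
        have := mul_le_mul h2 h2 (sq_nonneg d) (sq_nonneg C)
        nlinarith
      have h5 := mul_le_mul_of_nonneg_left h2 (sq_nonneg (M n ω))
      -- This yields 4Md³ ≤ 2M²d² + 2d⁴, whence the constants 8 = 6 + 2 and 3 = 1 + 2. The induction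
      -- then closes since 8n + 3 ≤ 4(n + 1)² - 4n².
      have h6 := mul_nonneg (sq_nonneg d) (sq_nonneg (M n ω - d))
      nlinarith
    rw [integral_add hi' (integrable_const _), integral_add hi ((hint' n 2).const_mul _),
      integral_add (hint' n 4) ((hint n 3 1).const_mul 4), integral_const_mul,
      integral_const_mul] at hle
    simp only [pow_one, h3, integral_const, probReal_univ, smul_eq_mul] at hle
    have h2 := mul_le_mul_of_nonneg_left (hsq n) (by positivity : 0 ≤ 8 * C ^ 2)
    have h4 : 0 ≤ C ^ 4 := by positivity
    push_cast
    nlinarith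

/-- A strong law of large numbers for sums of bounded increments which are orthogonal to the past
and to its cube. -/
lemma ae_tendsto_div_of_orthogonal (hM : ∀ n, AEStronglyMeasurable (M n) P) (h0 : M 0 = 0)
    (hC : ∀ n, ∀ᵐ ω ∂P, |M (n + 1) ω - M n ω| ≤ C)
    (h1 : ∀ n, ∫ ω, M n ω * (M (n + 1) ω - M n ω) ∂P = 0)
    (h3 : ∀ n, ∫ ω, M n ω ^ 3 * (M (n + 1) ω - M n ω) ∂P = 0) :
    ∀ᵐ ω ∂P, Tendsto (fun n : ℕ => M n ω / n) atTop (𝓝 0) := by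
  have hC0 : 0 ≤ C := by
    obtain ⟨ω, hω⟩ := (hC 0).exists
    exact (abs_nonneg _).trans hω
  have hb := ae_abs_le_of_abs_sub_le h0 hC
  have hterm (n : ℕ) : ∫⁻ ω, ENNReal.ofReal ((M n ω / n) ^ 4) ∂P ≤
      ENNReal.ofReal (4 * C ^ 4 * (1 / (n : ℝ) ^ 2)) := by
    have hint : Integrable (fun ω => (M n ω / n) ^ 4) P := by
      refine Integrable.of_bound (((hM n).mul_const (n : ℝ)⁻¹).pow 4) ((C * n / n) ^ 4) ?_
      filter_upwards [hb n] with ω h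
      rw [Real.norm_eq_abs, abs_pow, abs_div, Nat.abs_cast]
      gcongr
    rw [← ofReal_integral_eq_lintegral_ofReal hint (ae_of_all _ fun ω => by positivity)]
    refine ENNReal.ofReal_le_ofReal ?_
    simp only [div_pow]
    rw [integral_div]
    rcases Nat.eq_zero_or_pos n with rfl | hn
    · simp
    · have hn' : (0 : ℝ) < n := Nat.cast_pos.2 hn
      rw [div_le_iff₀ (by positivity)]
      refine (integral_pow_four_le hC0 hM h0 hC h1 h3 n).trans (le_of_eq ?_)
      field_simp
  -- The fourth powers have summable expectations, so their sum is almost surely finite and the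
  -- terms tend to 0.
  have hsum : ∑' n : ℕ, ∫⁻ ω, ENNReal.ofReal ((M n ω / n) ^ 4) ∂P ≠ ⊤ := by
    refine ne_top_of_le_ne_top ?_ (ENNReal.tsum_le_tsum hterm)
    have hs : Summable fun n : ℕ => 4 * C ^ 4 * (1 / (n : ℝ) ^ 2) :=
      (Real.summable_one_div_nat_pow.2 one_lt_two).mul_left _
    rw [← ENNReal.ofReal_tsum_of_nonneg (fun n => by positivity) hs]
    exact ENNReal.ofReal_ne_top
  have hmeas (n : ℕ) : AEMeasurable (fun ω => ENNReal.ofReal ((M n ω / n) ^ 4)) P :=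
    (((hM n).aemeasurable.div_const _).pow_const 4).ennreal_ofReal
  rw [← lintegral_tsum hmeas] at hsum
  filter_upwards [ae_lt_top' (AEMeasurable.tsum hmeas) hsum] with ω hω
  have h := ENNReal.tendsto_atTop_zero_of_tsum_ne_top hω.ne
  have h' := (ENNReal.continuousAt_toReal ENNReal.zero_ne_top).tendsto.comp h
  have h4 : Tendsto (fun n : ℕ => (M n ω / n) ^ 4) atTop (𝓝 0) := by
    refine h'.congr fun n => ?_
    simp only [Function.comp_apply]
    exact ENNReal.toReal_ofReal (by positivity)
  have h5 := h4.sqrt.sqrt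
  simp only [Real.sqrt_zero] at h5
  refine (tendsto_zero_iff_abs_tendsto_zero _).2 (h5.congr fun n => ?_)
  rw [show (M n ω / n) ^ 4 = ((M n ω / n) ^ 2) ^ 2 by ring, Real.sqrt_sq (sq_nonneg _),
    Real.sqrt_sq_eq_abs]
  rfl

/-- Almost sure convergence of a bounded sequence to a constant implies convergence in `L^r`. -/
lemma tendsto_eLpNorm_sub_of_ae_tendsto {Y : ℕ → Ω → ℝ} {γ : ℝ}
    (hY : ∀ n, AEStronglyMeasurable (Y n) P) (hb : ∀ n, ∀ᵐ ω ∂P, |Y n ω| ≤ C)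
    (hlim : ∀ᵐ ω ∂P, Tendsto (fun n => Y n ω) atTop (𝓝 γ)) {r : ENNReal} (hr : 1 ≤ r)
    (hr' : r ≠ ⊤) : Tendsto (fun n => eLpNorm (fun ω => Y n ω - γ) r P) atTop (𝓝 0) := by
  have hr0 : r ≠ 0 := (zero_lt_one.trans_le hr).ne'
  have hpos : 0 < r.toReal := ENNReal.toReal_pos hr0 hr'
  simp only [eLpNorm_eq_lintegral_rpow_enorm_toReal hr0 hr']
  have h : Tendsto (fun n => ∫⁻ ω, ‖Y n ω - γ‖ₑ ^ r.toReal ∂P) atTop (𝓝 (∫⁻ _, 0 ∂P)) := by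
    refine tendsto_lintegral_of_dominated_convergence' (fun _ => ENNReal.ofReal (C + |γ|) ^ r.toReal)
      (fun n => (((hY n).sub aestronglyMeasurable_const).enorm).pow_const _) ?_ ?_ ?_
    · intro n
      filter_upwards [hb n] with ω hω
      refine ENNReal.rpow_le_rpow ?_ hpos.le
      rw [← ofReal_norm, Real.norm_eq_abs]
      exact ENNReal.ofReal_le_ofReal ((abs_sub _ _).trans (by linarith))
    · simp only [lintegral_const, measure_univ, mul_one]
      exact ENNReal.rpow_ne_top_of_nonneg hpos.le ENNReal.ofReal_ne_top
    · filter_upwards [hlim] with ω hω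
      have h1 : Tendsto (fun n => ‖Y n ω - γ‖ₑ) atTop (𝓝 0) := by
        have := (hω.sub_const γ).enorm
        simpa using this
      have := (ENNReal.continuous_rpow_const (y := r.toReal)).tendsto 0 |>.comp h1
      simpa [Function.comp_def, ENNReal.zero_rpow_of_pos hpos] using this
  rw [lintegral_zero] at h
  have := (ENNReal.continuous_rpow_const (y := 1 / r.toReal)).tendsto 0 |>.comp h
  simpa [Function.comp_def, ENNReal.zero_rpow_of_pos (inv_pos.2 hpos)] using this

end BoundedIncrements

/-! ### Random walks supported on the letters -/

namespace C3FreeC3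

open AltWord

instance : DiscreteMeasurableSpace C3FreeC3 := ⟨fun _ => trivial⟩

instance : Countable C3FreeC3 := by
  have : Countable (FreeMonoid (C3 ⊕ C3)) := inferInstanceAs (Countable (List (C3 ⊕ C3)))
  exact Monoid.Coprod.mk_surjective.countable

/-- Letters of opposite sign are inverse, so the bound on the growth of length in one step also
bounds its decrease. -/
lemma act_not_act (t σ : Bool) (v : AltWord) : act t (!σ) (act t σ v) = v := by
  cases σ <;> simp [act, rot_rot_rot]

lemma walkPosition_eq_of_eq {G Ω Ω' : Type*} [Monoid G] {ξ : ℕ → Ω → G} {η : ℕ → Ω' → G} {ω : Ω}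
    {ω' : Ω'} {n : ℕ} (h : ∀ i < n, ξ i ω = η i ω') :
    walkPosition ξ n ω = walkPosition η n ω' := by
  induction n with
  | zero => rfl
  | succ n ih => rw [walkPosition, walkPosition, ih fun i hi => h i (by omega), h n (by omega)]

variable {Ω : Type*} [MeasurableSpace Ω] {P : Measure Ω}
  {ξ : ℕ → Ω → C3FreeC3}

lemma aemeasurable_walkPosition (hξ : ∀ n, AEMeasurable (ξ n) P) (n : ℕ) :
    AEMeasurable (walkPosition ξ n) P := by
  induction n with
  | zero => exact aemeasurable_const
  | succ n ih =>
    exact (Measurable.of_discrete (f := fun x : C3FreeC3 × C3FreeC3 => x.1 * x.2)).comp_aemeasurable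
      (ih.prodMk (hξ n))

lemma indepFun_walkPosition (hindep : iIndepFun ξ P) (hξ : ∀ n, AEMeasurable (ξ n) P) (n : ℕ) :
    IndepFun (walkPosition ξ n) (ξ n) P := by
  have h := hindep.indepFun_finset₀ (Finset.range n) {n} (by simp) hξ
  let f (x : Finset.range n → C3FreeC3) : C3FreeC3 :=
    -- The position at time n only reads increments with index below n, so the default value 1 is
    -- never used.
    walkPosition (fun i (_ : Unit) => if h : i ∈ Finset.range n then x ⟨i, h⟩ else 1) n ()
  let g (x : ({n} : Finset ℕ) → C3FreeC3) : C3FreeC3 := x ⟨n, Finset.mem_singleton_self n⟩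
  have h' := h.comp (Measurable.of_discrete (f := f)) (Measurable.of_discrete (f := g))
  have hf : walkPosition ξ n = f ∘ fun ω (i : Finset.range n) => ξ i ω := funext fun ω => by
    refine walkPosition_eq_of_eq fun i hi => ?_
    simp [hi]
  rw [hf]
  exact h'

/-- The step weights `m` describe the law of each increment, which is supported by the letters. -/
structure HasStepWeights (P : Measure Ω) (ξ : ℕ → Ω → C3FreeC3) (m : Bool → Bool → ℝ) : Prop where
  indep : iIndepFun ξ P
  aemeasurable : ∀ n, AEMeasurable (ξ n) P
  measureReal_eq : ∀ n t σ, P.real {ω | ξ n ω = letter t σ} = m t σ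
  sum_eq_one : ∀ t, m t true + m t false + (m (!t) true + m (!t) false) = 1

variable {m : Bool → Bool → ℝ} [IsProbabilityMeasure P]

/-- The four letters are distinct and their masses add up to 1. -/
lemma HasStepWeights.ae_letter (h : HasStepWeights P ξ m) (n : ℕ) :
    ∀ᵐ ω ∂P, ∃ t σ, ξ n ω = letter t σ := by
  have hnull (t σ : Bool) : NullMeasurableSet {ω | ξ n ω = letter t σ} P :=
    (h.aemeasurable n).nullMeasurableSet_preimage (MeasurableSet.of_discrete (s := {letter t σ}))
  have hU : {ω | ∃ t σ, ξ n ω = letter t σ} =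
      ⋃ x : Bool × Bool, {ω | ξ n ω = letter x.1 x.2} := by
    ext ω; simp
  have hnullU : NullMeasurableSet {ω | ∃ t σ, ξ n ω = letter t σ} P := by
    rw [hU]; exact NullMeasurableSet.iUnion fun x => hnull x.1 x.2
  have h1 : P {ω | ∃ t σ, ξ n ω = letter t σ} = 1 := by
    rw [hU, measure_iUnion₀ _ fun x : Bool × Bool => hnull x.1 x.2, tsum_fintype]
    · have h2 (x : Bool × Bool) : P {ω | ξ n ω = letter x.1 x.2} = ENNReal.ofReal (m x.1 x.2) := by
        rw [← h.measureReal_eq n, ofReal_measureReal]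
      have h0 (t σ : Bool) : 0 ≤ m t σ := by rw [← h.measureReal_eq 0]; exact measureReal_nonneg
      simp only [h2]
      rw [← ENNReal.ofReal_sum_of_nonneg fun x _ => h0 _ _, Fintype.sum_prod_type]
      have := h.sum_eq_one true
      simp only [Fintype.sum_bool, Bool.not_true] at this ⊢
      rw [this, ENNReal.ofReal_one]
    · intro x y hxy
      refine Disjoint.aedisjoint (Set.disjoint_left.2 fun ω hx hy => hxy ?_)
      obtain ⟨h1, h2⟩ := letter_injective (hx.symm.trans hy)
      exact Prod.ext h1 h2
  exact (prob_compl_eq_zero_iff₀ hnullU).2 h1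

lemma HasStepWeights.ae_len_le (h : HasStepWeights P ξ m) (n : ℕ) :
    ∀ᵐ ω ∂P, (word (walkPosition ξ n ω)).len ≤ n := by
  induction n with
  | zero => exact ae_of_all _ fun ω => by simp [walkPosition, AltWord.len]
  | succ n ih =>
    filter_upwards [ih, h.ae_letter n] with ω h1 ⟨t, σ, h2⟩
    rw [walkPosition, h2, word_mul_letter]
    exact (len_act_le _ _ _).trans (by omega)

/-- The conditional expectation of a function of the position and the increment, in integrated
form. -/
lemma HasStepWeights.integral_mul_eq (h : HasStepWeights P ξ m) (n : ℕ) (φ : C3FreeC3 → ℝ)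
    (ψ : C3FreeC3 → C3FreeC3 → ℝ) {B : ℝ}
    (hB : ∀ t σ, ∀ᵐ ω ∂P, |φ (walkPosition ξ n ω) * ψ (walkPosition ξ n ω) (letter t σ)| ≤ B) :
    ∫ ω, φ (walkPosition ξ n ω) * ψ (walkPosition ξ n ω) (ξ n ω) ∂P =
      ∫ ω, φ (walkPosition ξ n ω) *
        ∑ t, ∑ σ, m t σ * ψ (walkPosition ξ n ω) (letter t σ) ∂P := by
  have hX := aemeasurable_walkPosition h.aemeasurable n
  have hmeas (f : C3FreeC3 → ℝ) : AEStronglyMeasurable (fun ω => f (walkPosition ξ n ω)) P :=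
    ((Measurable.of_discrete (f := f)).comp_aemeasurable hX).aestronglyMeasurable
  have hmeas' (f : C3FreeC3 → ℝ) : AEStronglyMeasurable (fun ω => f (ξ n ω)) P :=
    ((Measurable.of_discrete (f := f)).comp_aemeasurable (h.aemeasurable n)).aestronglyMeasurable
  let I (t σ : Bool) (x : C3FreeC3) : ℝ := Set.indicator {letter t σ} 1 x
  have hI (t σ : Bool) : ∫ ω, I t σ (ξ n ω) ∂P = m t σ := by
    rw [← h.measureReal_eq n t σ]
    have hn : NullMeasurableSet {ω | ξ n ω = letter t σ} P :=
      (h.aemeasurable n).nullMeasurableSet_preimage (MeasurableSet.of_discrete (s := {letter t σ}))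
    have hi := integral_indicator₀ (f := fun _ => (1 : ℝ)) hn
    rw [setIntegral_const, smul_eq_mul, mul_one] at hi
    rw [← hi]
    rfl
  have hint (t σ : Bool) :
      Integrable (fun ω => φ (walkPosition ξ n ω) * ψ (walkPosition ξ n ω) (letter t σ)) P :=
    Integrable.of_bound (hmeas fun g => φ g * ψ g (letter t σ)) B (hB t σ)
  have hint' (t σ : Bool) : Integrable (fun ω =>
      φ (walkPosition ξ n ω) * ψ (walkPosition ξ n ω) (letter t σ) * I t σ (ξ n ω)) P := by
    refine (hint t σ).mul_bdd (c := 1) (hmeas' (I t σ)) (ae_of_all _ fun ω => ?_)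
    simp only [I, Set.indicator]
    split_ifs <;> simp
  have hae : ∀ᵐ ω ∂P, φ (walkPosition ξ n ω) * ψ (walkPosition ξ n ω) (ξ n ω) =
      ∑ t, ∑ σ, φ (walkPosition ξ n ω) * ψ (walkPosition ξ n ω) (letter t σ) *
        I t σ (ξ n ω) := by
    filter_upwards [h.ae_letter n] with ω ⟨t, σ, hω⟩
    have hz (t' σ' : Bool) (hne : ¬(t = t' ∧ σ = σ')) : I t' σ' (letter t σ) = 0 :=
      Set.indicator_of_notMem (s := {letter t' σ'})
        (fun hmem => hne (letter_injective hmem)) _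
    rw [hω, Fintype.sum_eq_single t fun t' ht => Finset.sum_eq_zero fun σ' _ => by
        rw [hz t' σ' fun hh => ht hh.1.symm, mul_zero],
      Fintype.sum_eq_single σ fun σ' hσ => by rw [hz t σ' fun hh => hσ hh.2.symm, mul_zero]]
    simp [I]
  rw [integral_congr_ae hae, integral_finsetSum _ fun t _ =>
    integrable_finsetSum _ fun σ _ => hint' t σ]
  simp only [Finset.mul_sum]
  rw [integral_finsetSum _ fun t _ => integrable_finsetSum _ fun σ _ => by
    simpa only [mul_left_comm] using (hint t σ).const_mul (m t σ)]
  refine Finset.sum_congr rfl fun t _ => ?_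
  rw [integral_finsetSum _ fun σ _ => hint' t σ, integral_finsetSum _ fun σ _ => by
    simpa only [mul_left_comm] using (hint t σ).const_mul (m t σ)]
  refine Finset.sum_congr rfl fun σ _ => ?_
  have hind := (indepFun_walkPosition h.indep h.aemeasurable n).comp
    (Measurable.of_discrete (f := fun g => φ g * ψ g (letter t σ)))
    (Measurable.of_discrete (f := I t σ))
  have := hind.integral_fun_mul_eq_mul_integral
    (hmeas fun g => φ g * ψ g (letter t σ)) (hmeas' (I t σ))
  simp only [Function.comp_apply] at this
  rw [this, hI, mul_comm, ← integral_const_mul]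
  simp only [mul_left_comm]

/-- Almost sure convergence of the normalized length gives the drift. -/
lemma HasStepWeights.hasDrift_of_ae (h : HasStepWeights P ξ m) {γ : ℝ}
    (hlim : ∀ᵐ ω ∂P,
      Tendsto (fun n : ℕ => ((word (walkPosition ξ n ω)).len : ℝ) / n) atTop (𝓝 γ)) :
    HasDrift P (freeProductGenerators C3 C3) (walkPosition ξ) γ := by
  refine ⟨by simpa only [wordLength_eq] using hlim, fun r hr hr' => ?_⟩
  simp only [wordLength_eq]
  refine tendsto_eLpNorm_sub_of_ae_tendsto (C := 1) (fun n => ?_) (fun n => ?_) hlim hr hr'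
  · exact ((Measurable.of_discrete (f := fun g : C3FreeC3 => ((word g).len : ℝ) / n)).comp_aemeasurable
      (aemeasurable_walkPosition h.aemeasurable n)).aestronglyMeasurable
  · filter_upwards [h.ae_len_le n] with ω hω
    rw [abs_of_nonneg (by positivity)]
    exact div_le_one_of_le₀ (Nat.cast_le.2 hω) (by positivity)

/-- A walk with stationary weights has drift given by its rate of escape. -/
theorem HasStepWeights.hasDrift (h : HasStepWeights P ξ m) {ν : Bool → Bool → ℝ}
    (hν : IsStationary m ν) :
    HasDrift P (freeProductGenerators C3 C3) (walkPosition ξ) (escapeRate m ν) := by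
  refine h.hasDrift_of_ae ?_
  obtain ⟨K, hK⟩ := exists_abs_len_sub_height_le hν
  set γ := escapeRate m ν
  let F (g : C3FreeC3) : ℝ := height ν (word g)
  let M (n : ℕ) (ω : Ω) : ℝ := F (walkPosition ξ n ω) - γ * n
  -- The length changes by at most 1, and passing from length to `height` costs K at each end of the
  -- step.
  let C : ℝ := 1 + 2 * K + |γ|
  have hstep (g : C3FreeC3) (t σ : Bool) : |F (g * letter t σ) - F g - γ| ≤ C := by
    have h1 : ((word (g * letter t σ)).len : ℝ) ≤ (word g).len + 1 := by
      rw [word_mul_letter]; exact_mod_cast len_act_le t σ (word g)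
    have h2 : ((word g).len : ℝ) ≤ (word (g * letter t σ)).len + 1 := by
      rw [word_mul_letter]
      have := len_act_le t (!σ) (act t σ (word g))
      rw [act_not_act] at this
      exact_mod_cast this
    have h3 := abs_le.1 (hK (word g))
    have h4 := abs_le.1 (hK (word (g * letter t σ)))
    have h5 := le_abs_self γ
    have h6 := neg_abs_le γ
    simp only [F, C]
    exact abs_le.2 ⟨by linarith, by linarith⟩
  have hharm (g : C3FreeC3) : ∑ t, ∑ σ, m t σ * (F (g * letter t σ) - F g - γ) = 0 := by
    have h1 := sum_height_act hν h.sum_eq_one (word g)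
    have h2 := h.sum_eq_one true
    simp only [F, word_mul_letter, Fintype.sum_bool, Bool.not_true] at h1 h2 ⊢
    linear_combination h1 - (height ν (word g) + γ) * h2
  have hΔ (n : ℕ) (ω : Ω) : M (n + 1) ω - M n ω =
      F (walkPosition ξ n ω * ξ n ω) - F (walkPosition ξ n ω) - γ := by
    simp only [M, walkPosition]; push_cast; ring
  have hM0 : M 0 = 0 := by
    funext ω
    simp [M, F, walkPosition, height]
  have hMmeas (n : ℕ) : AEStronglyMeasurable (M n) P :=
    ((Measurable.of_discrete (f := fun g : C3FreeC3 => F g - γ * n)).comp_aemeasurable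
      (aemeasurable_walkPosition h.aemeasurable n)).aestronglyMeasurable
  have hMC (n : ℕ) : ∀ᵐ ω ∂P, |M (n + 1) ω - M n ω| ≤ C := by
    filter_upwards [h.ae_letter n] with ω ⟨t, σ, hω⟩
    rw [hΔ, hω]
    exact hstep _ _ _
  -- The increment has conditional mean zero by `hharm`, so it is orthogonal to every power of the
  -- past value; k = 1 and k = 3 are needed.
  have horth (k n : ℕ) : ∫ ω, M n ω ^ k * (M (n + 1) ω - M n ω) ∂P = 0 := by
    simp only [hΔ]
    have hb := ae_abs_le_of_abs_sub_le hM0 hMC n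
    have := h.integral_mul_eq n (fun g => (F g - γ * n) ^ k) (fun g s => F (g * s) - F g - γ)
      (B := (C * n) ^ k * C) fun t σ => by
        filter_upwards [hb] with ω hω
        rw [abs_mul, abs_pow]
        have := hstep (walkPosition ξ n ω) t σ
        exact mul_le_mul (pow_le_pow_left₀ (abs_nonneg _) hω k) this (abs_nonneg _)
          (pow_nonneg ((abs_nonneg _).trans hω) k)
    refine this.trans ?_
    simp only [hharm, mul_zero, integral_zero]
  have hlim := ae_tendsto_div_of_orthogonal hMmeas hM0 hMC
    (fun n => by simpa only [pow_one] using horth 1 n) (horth 3)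
  filter_upwards [hlim] with ω hω
  have hK' : Tendsto (fun n : ℕ => (((word (walkPosition ξ n ω)).len : ℝ) -
      F (walkPosition ξ n ω)) / n) atTop (𝓝 0) := by
    refine squeeze_zero_norm (fun n => ?_) (tendsto_const_div_atTop_nhds_zero_nat K)
    rw [Real.norm_eq_abs, abs_div, Nat.abs_cast]
    exact div_le_div_of_nonneg_right (hK _) (Nat.cast_nonneg n)
  have hsum := (hω.add hK').add_const γ
  rw [add_zero, zero_add] at hsum
  refine hsum.congr' ?_
  filter_upwards [eventually_gt_atTop 0] with n hn
  have hn' : (n : ℝ) ≠ 0 := by positivity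
  simp only [M]
  field_simp
  ring

/-- A walk with increments in one factor has drift zero. -/
lemma HasStepWeights.hasDrift_zero (h : HasStepWeights P ξ m) (t : Bool) (h0 : ∀ σ, m (!t) σ = 0) :
    HasDrift P (freeProductGenerators C3 C3) (walkPosition ξ) 0 := by
  refine h.hasDrift_of_ae ?_
  have hξ (n : ℕ) : ∀ᵐ ω ∂P, ∃ σ, ξ n ω = letter t σ := by
    have hz (σ : Bool) : ∀ᵐ ω ∂P, ξ n ω ≠ letter (!t) σ := by
      have := h.measureReal_eq n (!t) σ
      rw [h0, measureReal_eq_zero_iff] at this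
      simpa [ae_iff] using this
    filter_upwards [h.ae_letter n, hz true, hz false] with ω ⟨t', σ, hω⟩ h1 h2
    by_cases htt : t' = t
    · exact ⟨σ, htt ▸ hω⟩
    · obtain rfl : t' = !t := by cases t <;> cases t' <;> simp_all
      cases σ
      · exact absurd hω h2
      · exact absurd hω h1
  filter_upwards [ae_all_iff.2 hξ] with ω hω
  have hword (n : ℕ) : word (walkPosition ξ n ω) = AltWord.one ∨
      ∃ σ, word (walkPosition ξ n ω) = AltWord.cons t σ [] := by
    induction n with
    | zero => exact Or.inl (by simp [walkPosition])
    | succ n ih =>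
      obtain ⟨τ, hτ⟩ := hω n
      rw [walkPosition, hτ, word_mul_letter]
      rcases ih with ih | ⟨σ, ih⟩ <;> rw [ih]
      · exact Or.inr ⟨τ, act_ofList_not t τ []⟩
      · by_cases hστ : σ = τ
        · exact Or.inr ⟨!τ, by rw [hστ, act_cons_self]⟩
        · obtain rfl : τ = !σ := by cases σ <;> cases τ <;> simp_all
          exact Or.inl (by rw [act_cons_not]; rfl)
  refine squeeze_zero_norm (fun n => ?_) (tendsto_const_div_atTop_nhds_zero_nat 1)
  rw [Real.norm_eq_abs, abs_div, Nat.abs_cast, Nat.abs_cast]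
  refine div_le_div_of_nonneg_right ?_ (Nat.cast_nonneg n)
  rcases hword n with hn | ⟨σ, hn⟩ <;> rw [hn] <;> simp [AltWord.len]

end C3FreeC3

/-! ### The three drift formulas -/

open C3FreeC3 AltWord

theorem mainTheorem7 {Ω : Type*} [MeasurableSpace Ω] (P : Measure Ω) [IsProbabilityMeasure P]
    (μ : Measure C3FreeC3) [IsProbabilityMeasure μ]
    (ξ : ℕ → Ω → C3FreeC3) (hindep : iIndepFun ξ P) (hlaw : ∀ n, HasLaw (ξ n) μ P) :
    (∀ p : ℝ,
      μ.real {C3FreeC3.a} = p → μ.real {C3FreeC3.b} = p →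
      μ.real {C3FreeC3.a ^ 2} = 1 / 2 - p → μ.real {C3FreeC3.b ^ 2} = 1 / 2 - p →
      HasDrift P (freeProductGenerators C3 C3) (walkPosition ξ)
        (-1 / 4 + Real.sqrt (16 * p ^ 2 - 8 * p + 5) / 4)) ∧
    (∀ p : ℝ,
      μ.real {C3FreeC3.a} = p → μ.real {C3FreeC3.a ^ 2} = p →
      μ.real {C3FreeC3.b} = 1 / 2 - p → μ.real {C3FreeC3.b ^ 2} = 1 / 2 - p →
      HasDrift P (freeProductGenerators C3 C3) (walkPosition ξ) (2 * p * (1 - 2 * p))) ∧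
    (∀ p q : ℝ,
      μ.real {C3FreeC3.a} = p → μ.real {C3FreeC3.a ^ 2} = q →
      μ.real {C3FreeC3.b} = (1 - p - q) / 2 → μ.real {C3FreeC3.b ^ 2} = (1 - p - q) / 2 →
      HasDrift P (freeProductGenerators C3 C3) (walkPosition ξ)
        (2 * (1 - p - q) *
          Real.sqrt ((p ^ 2 + q ^ 2 + p * q) / (p ^ 2 + q ^ 2 - 2 * p * q + 3)))) := by
  have hsteps (m : Bool → Bool → ℝ) (hm : ∀ t σ, μ.real {letter t σ} = m t σ)
      (hsum : ∀ t, m t true + m t false + (m (!t) true + m (!t) false) = 1) :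
      HasStepWeights P ξ m :=
    ⟨hindep, fun n => (hlaw n).aemeasurable, fun n t σ => by
      rw [← hm, (hlaw n).measureReal_eq (p := fun x => x = letter t σ) MeasurableSet.of_discrete]
      rfl, hsum⟩
  have hthird (p q : ℝ) (ha : μ.real {C3FreeC3.a} = p) (ha2 : μ.real {C3FreeC3.a ^ 2} = q)
      (hb : μ.real {C3FreeC3.b} = (1 - p - q) / 2)
      (hb2 : μ.real {C3FreeC3.b ^ 2} = (1 - p - q) / 2) :
      HasDrift P (freeProductGenerators C3 C3) (walkPosition ξ)
        (2 * (1 - p - q) *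
          Real.sqrt ((p ^ 2 + q ^ 2 + p * q) / (p ^ 2 + q ^ 2 - 2 * p * q + 3))) := by
    have hp : 0 ≤ p := ha ▸ measureReal_nonneg
    have hq : 0 ≤ q := ha2 ▸ measureReal_nonneg
    have hpq : 0 ≤ (1 - p - q) / 2 := hb ▸ measureReal_nonneg
    have hsw := hsteps (fun t σ => if t then (1 - p - q) / 2 else if σ then p else q)
      (fun t σ => by cases t <;> cases σ <;> simp [letter, ha, ha2, hb, hb2])
      (fun t => by cases t <;> simp)
    -- For p + q = 0 or 1 the walk stays in one finite factor, and the formula vanishes as well.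
    rcases (add_nonneg hp hq).eq_or_lt with h0 | h0
    · obtain rfl : p = 0 := by linarith
      obtain rfl : q = 0 := by linarith
      simpa using hsw.hasDrift_zero true fun σ => by simp
    rcases (show p + q ≤ 1 by linarith).eq_or_lt with h1 | h1
    · have hz : 1 - p - q = 0 := by linarith
      rw [hz, mul_zero, zero_mul]
      exact hsw.hasDrift_zero false fun σ => by simp [hz]
    · obtain ⟨ν, hν, hγ⟩ := exists_isStationary_of_symm_factor hp hq h0 h1
      rw [← hγ]
      exact hsw.hasDrift hν
  refine ⟨fun p ha hb ha2 hb2 => ?_, fun p ha ha2 hb hb2 => ?_, hthird⟩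
  · have hp : 0 ≤ 1 / 2 - p := ha2 ▸ measureReal_nonneg
    obtain ⟨ν, hν, hγ⟩ := exists_isStationary_of_factor_symm (p := p) (by linarith)
    rw [← hγ]
    refine (hsteps _ (fun t σ => ?_) fun t => ?_).hasDrift hν
    · cases t <;> cases σ <;> simp [letter, ha, ha2, hb, hb2]
    · simp; norm_num
  · have hp : 0 ≤ p := ha ▸ measureReal_nonneg
    have h := hthird p p ha ha2 (by rw [hb]; ring) (by rw [hb2]; ring)
    -- On the diagonal q = p the radicand is a perfect square.
    have hs : (p ^ 2 + p ^ 2 + p * p) / (p ^ 2 + p ^ 2 - 2 * p * p + 3) = p ^ 2 := by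
      rw [show p ^ 2 + p ^ 2 - 2 * p * p + 3 = 3 by ring]; ring
    rw [hs, Real.sqrt_sq hp] at h
    convert h using 1
    ring
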